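/- Let $G=(X\,\dot\cup\,Y,E)$ be a finite bipartite graph, and let $\mathcal P_X$ and $\mathcal P_Y$ be partitions of $X$ and $Y$ such that for every $i\in X$ there is a $J\in\mathcal P_Y$ with $N(i)\subseteq J$, and for every $j\in Y$ there is an $I\in\mathcal P_X$ with $N(j)\subseteq I$. Let $Q$ be the convex hull of all points $(x,y,z)\in\{0,1\}^{X\cup Y\cup E}$ such that $$\sum_{i\in I}x_i=1\ (I\in\mathcal P_X),\qquad \sum_{j\in J}y_j=1\ (J\in\mathcal P_Y),\qquad \sum_{e\in E}z_e\ge 1,$$ and, for all $\{i,j\}\in E$ with $i\in X$, $j\in Y$, $z_{ij}\le x_i$ and $z_{ij}\le y_j$. Then $$Q=\Bigl\{(x,y,z)\in[0,1]^{X\cup Y\cup E}:\ \sum_{i\in I}x_i=1\ (I\in\mathcal P_X),\ \sum_{j\in J}y_j=1\ (J\in\mathcal P_Y),\ \sum_{e\in E}z_e\ge1,\ \sum_{j\in N(i)}z_{ij}\le x_i\ (i\in X),\ \sum_{i\in N(j)}z_{ij}\le y_j\ (j\in Y)\Bigr\}.$$ In particular, let $H=(V,E_H)$ be a finite simple graph,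 let $\bar E$ be the set of arcs $(i,j)$ and $(j,i)$ of all edges $\{i,j\}\in E_H$, let $T\in\mathbb N$, and write $[T]=\{1,\dots,T\}$. Fix a pair $(p,q)$ of distinct labels and consider variables $w^t_{pi},w^t_{qi}$ ($t\in[T]$, $i\in V$) and $y^t_{pqij}$ ($t\in[T]$, $(i,j)\in\bar E$). Let $P^\le_{pq}$ be the convex hull of all $\{0,1\}$-valued points with $\sum_{i\in V}w^t_{pi}=\sum_{i\in V}w^t_{qi}=1$ for all $t\in[T]$, $\sum_{t\in[T]}\sum_{(i,j)\in\bar E}y^t_{pqij}\ge1$, and $y^t_{pqij}\le w^t_{pi}$, $y^t_{pqij}\le w^t_{qj}$ for all $t\in[T]$, $(i,j)\in\bar E$. Then $P^\le_{pq}$ is the set of all $[0,1]$-valued points with $\sum_{i\in V}w^t_{pi}=\sum_{i\in V}w^t_{qi}=1$ for all $t\in[T]$, $\sum_{t\in[T]}\sum_{(i,j)\in\bar E}y^t_{pqij}\ge1$, and, for all $t\in[T]$ and $i\in V$, $\sum_{j\in N(i)}y^t_{pqij}\le w^t_{pi}$ and $\sum_{j\in N(i)}y^t_{pqji}\le w^t_{qi}$.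 -/

import Mathlib

universe u v

namespace PartitionPolytope

section Bipartite

variable {V : Type u} [Fintype V] [DecidableEq V] (G : SimpleGraph V) [DecidableRel G.Adj]

/-- The ambient space `ℝ^(V ∪ E)` of a graph on the vertex set `V = X ∪ Y` with edge set `E`.
The first component holds the node variables (`x` is its restriction to `X`, and `y` is its
restriction to `Y`), the second one holds the edge variables `z`. -/
abbrev Point : Type u := (V → ℝ) × (G.edgeSet → ℝ)

variable {G}

/-- The value `z_ij` at the edge `{i, j}`. -/
def Point.z (p : Point G) {i j : V} (h : G.Adj i j) : ℝ := p.2 ⟨s(i, j), h⟩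

/-- All coordinates are in `{0, 1}`. -/
def Point.IsBinary (p : Point G) : Prop :=
  (∀ i, p.1 i = 0 ∨ p.1 i = 1) ∧ ∀ e, p.2 e = 0 ∨ p.2 e = 1

/-- All coordinates are in `[0, 1]`. -/
def Point.InUnitBox (p : Point G) : Prop :=
  (∀ i, p.1 i ∈ Set.Icc (0 : ℝ) 1) ∧ ∀ e, p.2 e ∈ Set.Icc (0 : ℝ) 1

/-- The node variables sum up to one over every part of the partition `P`. -/
def Point.SumsToOne (p : Point G) {S : Finset V} (P : Finpartition S) : Prop :=
  ∀ I ∈ P.parts, ∑ i ∈ I, p.1 i = 1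

/-- `z(E) ≥ 1`. -/
def Point.CoversOne (p : Point G) : Prop := 1 ≤ ∑ e : G.edgeSet, p.2 e

variable (G)

/-- The convex hull of all binary points `(x, y, z)` with `x(I) = 1` for the parts `I` of `PX`,
`y(J) = 1` for the parts `J` of `PY`, `z_ij ≤ x_i` and `z_ij ≤ y_j` for the edges `{i, j}`
(where `i ∈ X` and `j ∈ Y`), and `z(E) ≥ 1`. -/
def hullQ {X Y : Finset V} (PX : Finpartition X) (PY : Finpartition Y) : Set (Point G) :=
  convexHull ℝ {p | p.IsBinary ∧ p.SumsToOne PX ∧ p.SumsToOne PY ∧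
    (∀ i ∈ X, ∀ j ∈ Y, ∀ h : G.Adj i j, p.z h ≤ p.1 i) ∧
    (∀ i ∈ X, ∀ j ∈ Y, ∀ h : G.Adj i j, p.z h ≤ p.1 j) ∧
    p.CoversOne}

/-- The polytope of all points `(x, y, z)` of the unit box with `x(I) = 1` for the parts `I` of
`PX`, `y(J) = 1` for the parts `J` of `PY`, `z(E) ≥ 1`, and the aggregated inequalities
`∑_{j ∈ N(i)} z_ij ≤ x_i` for `i ∈ X` and `∑_{i ∈ N(j)} z_ij ≤ y_j` for `j ∈ Y`. -/
def polyP {X Y : Finset V} (PX : Finpartition X) (PY : Finpartition Y) : Set (Point G) :=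
  {p | p.InUnitBox ∧ p.SumsToOne PX ∧ p.SumsToOne PY ∧ p.CoversOne ∧
    (∀ i ∈ X, ∑ j : G.neighborSet i, p.z j.2 ≤ p.1 i) ∧
    (∀ j ∈ Y, ∑ i : G.neighborSet j, p.z (G.adj_symm i.2) ≤ p.1 j)}

end Bipartite

section Connection

variable {V : Type v} [Fintype V] (H : SimpleGraph V) [DecidableRel H.Adj] (T : ℕ)

/-- The variables that belong to a fixed connection `(p, q)`: `wp t i` and `wq t i` locate the
tokens `p` and `q` at step `t`, and `y t a` is the connection variable of the arc `a = (i, j)`.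
The darts of `H` are the arcs `(i, j)` and `(j, i)` of its edges `{i, j}`. -/
abbrev ConnPoint : Type v := (Fin T → V → ℝ) × (Fin T → V → ℝ) × (Fin T → H.Dart → ℝ)

variable {H T}

def ConnPoint.wp (c : ConnPoint H T) : Fin T → V → ℝ := c.1

def ConnPoint.wq (c : ConnPoint H T) : Fin T → V → ℝ := c.2.1

def ConnPoint.y (c : ConnPoint H T) : Fin T → H.Dart → ℝ := c.2.2

def ConnPoint.IsBinary (c : ConnPoint H T) : Prop :=
  (∀ t i, c.wp t i = 0 ∨ c.wp t i = 1) ∧ (∀ t i, c.wq t i = 0 ∨ c.wq t i = 1) ∧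
    ∀ t a, c.y t a = 0 ∨ c.y t a = 1

def ConnPoint.InUnitBox (c : ConnPoint H T) : Prop :=
  (∀ t i, c.wp t i ∈ Set.Icc (0 : ℝ) 1) ∧ (∀ t i, c.wq t i ∈ Set.Icc (0 : ℝ) 1) ∧
    ∀ t a, c.y t a ∈ Set.Icc (0 : ℝ) 1

/-- At every step each of the two tokens is at exactly one node. -/
def ConnPoint.Assigned (c : ConnPoint H T) : Prop :=
  (∀ t, ∑ i, c.wp t i = 1) ∧ ∀ t, ∑ i, c.wq t i = 1

variable [DecidableEq V]

/-- The two tokens meet at least once. -/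
def ConnPoint.Meets (c : ConnPoint H T) : Prop := 1 ≤ ∑ t, ∑ a, c.y t a

variable (H T)

/-- The convex hull of the binary points that satisfy the assignment constraints, the meeting
constraint, and `y^t_pqij ≤ w^t_pi`, `y^t_pqij ≤ w^t_qj` for all arcs `(i, j)` and steps `t`. -/
def connHull : Set (ConnPoint H T) :=
  convexHull ℝ {c | c.IsBinary ∧ c.Assigned ∧ c.Meets ∧
    (∀ t a, c.y t a ≤ c.wp t a.fst) ∧ (∀ t a, c.y t a ≤ c.wq t a.snd)}

/-- The points of the unit box that satisfy the assignment constraints, the meeting constraint,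
`∑_{j ∈ N(i)} y^t_pqij ≤ w^t_pi` and `∑_{j ∈ N(i)} y^t_pqji ≤ w^t_qi` for all `i` and `t`. -/
def connPoly : Set (ConnPoint H T) :=
  {c | c.InUnitBox ∧ c.Assigned ∧ c.Meets ∧
    (∀ t i, ∑ j : H.neighborSet i, c.y t ⟨(i, j), j.2⟩ ≤ c.wp t i) ∧
    (∀ t i, ∑ j : H.neighborSet i, c.y t ⟨(j, i), H.adj_symm j.2⟩ ≤ c.wq t i)}

end Connection

end PartitionPolytope

/-! Both equalities are instances of `PairSelection.convexHull_binaryPoints`. It treats links `e`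
with ends `a e : X`, `b e : Y`, where `X` and `Y` are partitioned into the fibres of `π` and `ρ`.

For the inclusion of the hull in the polytope, the links at `i` lead to distinct elements of a
single fibre of `ρ`. A binary point selects exactly one element of that fibre, so at most one of
these links is selected, and none if `x i = 0`. This is `sum_links_le`, used for both sides.

For the converse, the linear system is a network flow problem once slacks are added. One unit leaves
each class `k`, enters some `i` along an arc with flow `x i`, and then either crosses to `Y` along a
link or takes a slack arc. Units on slack arcs pass through one bottleneck arc before they are
redistributed to `Y`, where the arcs with flow `y j` lead to the classes `l`. Since `z(E) = |K| -
slack`, capacity `|K| - 1` on the bottleneck says exactly `z(E) ≥ 1`. The data are integral, so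
`flows_subset_convexHull` writes every feasible flow as a convex combination of integral ones, and
`project` maps these to binary points. -/

set_option linter.unusedSectionVars false
set_option linter.unusedSimpArgs false

/-! ### Integrality of flow polytopes with integral data. -/

namespace IntegralFlow

open Finset

section Excess

variable {A N : Type*} [Fintype A] [DecidableEq N]

/-- The net outflow of `f` at the node `n`. -/
def excess (tail head : A → N) (n : N) : (A → ℝ) →ₗ[ℝ] ℝ where
  toFun f := ∑ a, (if tail a = n then f a else 0) - ∑ a, (if head a = n then f a else 0)
  map_add' f g := by
    simp only [← sum_sub_distrib, ← sum_add_distrib, Pi.add_apply]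
    exact sum_congr rfl fun a _ => by split_ifs <;> ring
  map_smul' c f := by
    simp only [← sum_sub_distrib, mul_sum, Pi.smul_apply, smul_eq_mul, RingHom.id_apply]
    exact sum_congr rfl fun a _ => by split_ifs <;> ring

theorem excess_apply (tail head : A → N) (n : N) (f : A → ℝ) :
    excess tail head n f =
      ∑ a, (if tail a = n then f a else 0) - ∑ a, (if head a = n then f a else 0) := rfl

/-- Every arc is counted once at its tail and once, with opposite sign, at its head. Hence the
excess map is never onto, which is what produces a kernel in `exists_perturbation`. -/
theorem sum_excess [Fintype N] (tail head : A → N) (f : A → ℝ) :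
    ∑ n, excess tail head n f = 0 := by
  simp only [excess_apply, sum_sub_distrib]
  rw [sum_comm, sum_comm (f := fun n a => if head a = n then f a else 0)]
  simp

/-- The flows with excess `b` and bounds `l` and `u`. -/
def flows (tail head : A → N) (b : N → ℤ) (l u : A → ℤ) : Set (A → ℝ) :=
  {f | (∀ a, (l a : ℝ) ≤ f a ∧ f a ≤ u a) ∧ ∀ n, excess tail head n f = b n}

/-- The additive group of the real numbers that are integers. -/
abbrev integers : AddSubgroup ℝ := (Int.castAddHom ℝ).range

theorem sum_ite_sub_mem_integers [DecidableEq A] (t : A → N) (n : N) (f : A → ℝ) (F : Finset A)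
    (hF : ∀ a, a ∉ F → f a ∈ integers) :
    ∑ a, (if t a = n then f a else 0) - ∑ a ∈ F with t a = n, f a ∈ integers := by
  rw [sum_filter, ← sum_sdiff (subset_univ F), add_sub_cancel_right]
  refine sum_mem fun a ha => ?_
  split_ifs
  · exact hF a (mem_sdiff.1 ha).2
  · exact zero_mem _

/-- No node is incident to exactly one end of an arc that carries a fractional flow. -/
theorem two_le_card_fractional [DecidableEq A] (tail head : A → N) (n : N) (f : A → ℝ)
    (F : Finset A) (hF : ∀ a, a ∈ F ↔ f a ∉ integers)
    (hn : excess tail head n f ∈ integers)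
    (hpos : 0 < #{a ∈ F | tail a = n} + #{a ∈ F | head a = n}) :
    2 ≤ #{a ∈ F | tail a = n} + #{a ∈ F | head a = n} := by
  by_contra hlt
  have key : ∑ a ∈ F with tail a = n, f a - ∑ a ∈ F with head a = n, f a ∈ integers := by
    have ht := sum_ite_sub_mem_integers tail n f F fun a ha => by
      simpa using mt (hF a).2 ha
    have hh := sum_ite_sub_mem_integers head n f F fun a ha => by
      simpa using mt (hF a).2 ha
    have := add_mem (sub_mem hn ht) hh
    rw [excess_apply] at this
    convert this using 1
    ring
  -- With a single fractional end at `n`, `key` would make that fractional value an integer up to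
  -- sign.
  have h1 : (#{a ∈ F | tail a = n} = 1 ∧ #{a ∈ F | head a = n} = 0) ∨
      (#{a ∈ F | tail a = n} = 0 ∧ #{a ∈ F | head a = n} = 1) := by omega
  rcases h1 with ⟨ht, hh⟩ | ⟨ht, hh⟩
  · obtain ⟨a, ha⟩ := card_eq_one.1 ht
    rw [card_eq_zero.1 hh, ha, sum_empty, sum_singleton, sub_zero] at key
    have : a ∈ F := (mem_filter.1 (ha ▸ mem_singleton_self a)).1
    exact (hF a).1 this key
  · obtain ⟨a, ha⟩ := card_eq_one.1 hh
    rw [card_eq_zero.1 ht, ha, sum_empty, sum_singleton, zero_sub, neg_mem_iff] at key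
    have : a ∈ F := (mem_filter.1 (ha ▸ mem_singleton_self a)).1
    exact (hF a).1 this key

/-- A flow with integral excesses that is not integral can be perturbed on its fractional arcs. -/
theorem exists_perturbation [Fintype N] (tail head : A → N) (f : A → ℝ)
    (hf : ∀ n, excess tail head n f ∈ integers) (hfrac : ∃ a, f a ∉ integers) :
    ∃ d : A → ℝ, d ≠ 0 ∧ (∀ a, f a ∈ integers → d a = 0) ∧
      ∀ n, excess tail head n d = 0 := by
  classical
  set F : Finset A := {a | f a ∉ integers} with hFdef
  have hF : ∀ a, a ∈ F ↔ f a ∉ integers := fun a => by simp [hFdef]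
  obtain ⟨a₀, ha₀⟩ := hfrac
  set M : Finset N := F.image tail ∪ F.image head with hM
  have htM : ∀ a ∈ F, tail a ∈ M := fun a ha => mem_union_left _ (mem_image_of_mem _ ha)
  have hhM : ∀ a ∈ F, head a ∈ M := fun a ha => mem_union_right _ (mem_image_of_mem _ ha)
  -- Double counting: the fractional arcs have `2 * #F` ends in total, and each node of `M` receives
  -- at least two of them.
  have hcard : #M ≤ #F := by
    have h2 : ∑ n ∈ M, 2 ≤ ∑ n ∈ M, (#{a ∈ F | tail a = n} + #{a ∈ F | head a = n}) := by
      refine sum_le_sum fun n hn => two_le_card_fractional tail head n f F hF (hf n) ?_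
      rcases mem_union.1 hn with h | h
      · obtain ⟨a, ha, hn⟩ := mem_image.1 h
        have : 0 < #{a ∈ F | tail a = n} := card_pos.2 ⟨a, mem_filter.2 ⟨ha, hn⟩⟩
        omega
      · obtain ⟨a, ha, hn⟩ := mem_image.1 h
        have : 0 < #{a ∈ F | head a = n} := card_pos.2 ⟨a, mem_filter.2 ⟨ha, hn⟩⟩
        omega
    rw [sum_add_distrib, ← card_eq_sum_card_fiberwise htM, ← card_eq_sum_card_fiberwise hhM,
      sum_const, smul_eq_mul] at h2
    omega
  let ext : (F → ℝ) →ₗ[ℝ] (A → ℝ) := Function.ExtendByZero.linearMap ℝ Subtype.val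
  have ext_mem : ∀ g (a : F), ext g a = g a := fun g a =>
    Subtype.val_injective.extend_apply g (0 : A → ℝ) a
  have ext_notMem : ∀ g a, a ∉ F → ext g a = 0 := fun g a ha =>
    Function.extend_apply' g (0 : A → ℝ) a fun ⟨b, hb⟩ => ha (hb ▸ b.2)
  have excess_ext : ∀ g n, n ∉ M → excess tail head n (ext g) = 0 := fun g n hn => by
    rw [excess_apply, sum_eq_zero, sum_eq_zero, sub_zero]
    · intro a _
      split_ifs with h
      · exact ext_notMem g a fun ha => hn (h ▸ hhM a ha)
      · rfl
    · intro a _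
      split_ifs with h
      · exact ext_notMem g a fun ha => hn (h ▸ htM a ha)
      · rfl
  let Φ : (F → ℝ) →ₗ[ℝ] (M → ℝ) := LinearMap.pi fun m => excess tail head m ∘ₗ ext
  have hsum : ∀ g, ∑ m, Φ g m = 0 := fun g => by
    rw [← sum_excess tail head (ext g), ← sum_subset (subset_univ M)
      fun n _ hn => excess_ext g n hn]
    exact sum_coe_sort M fun n => excess tail head n (ext g)
  -- Injectivity together with `#M ≤ #F` would make `Φ` bijective, but its values have coordinate
  -- sum zero, so the constant 1 is not attained on the nonempty `M`.
  have hinj : ¬ Function.Injective Φ := fun hinj => by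
    have hle := LinearMap.finrank_le_finrank_of_injective hinj
    have heq : Module.finrank ℝ (F → ℝ) = Module.finrank ℝ (M → ℝ) := by
      simp only [Module.finrank_fintype_fun_eq_card, Fintype.card_coe] at hle ⊢
      omega
    obtain ⟨g, hg⟩ := (LinearMap.injective_iff_surjective_of_finrank_eq_finrank heq).1 hinj
      (fun _ => 1)
    have h := hsum g
    have : 0 < #M := card_pos.2 ⟨_, htM a₀ ((hF a₀).2 ha₀)⟩
    rw [hg] at h
    simp only [sum_const, card_univ, Fintype.card_coe, nsmul_eq_mul, mul_one, Nat.cast_eq_zero] at h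
    omega
  rw [← LinearMap.ker_eq_bot, Submodule.eq_bot_iff] at hinj
  push Not at hinj
  obtain ⟨g, hg, hg0⟩ := hinj
  refine ⟨ext g, fun h => hg0 ?_, fun a ha => ext_notMem g a fun h => (hF a).1 h ha, fun n => ?_⟩
  · ext a
    rw [← ext_mem g a, h]; rfl
  · by_cases hn : n ∈ M
    · exact congrFun hg ⟨n, hn⟩
    · exact excess_ext g n hn

theorem convex_flows (tail head : A → N) (b : N → ℤ) (l u : A → ℤ) :
    Convex ℝ (flows tail head b l u) := by
  rintro f ⟨hf, hfb⟩ g ⟨hg, hgb⟩ s t hs ht hst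
  refine ⟨fun a => ?_, fun n => ?_⟩
  · exact convex_Icc (l a : ℝ) (u a : ℝ) (hf a) (hg a) hs ht hst
  · rw [map_add, map_smul, map_smul, hfb, hgb, ← add_smul, hst, one_smul]

theorem isCompact_flows (tail head : A → N) (b : N → ℤ) (l u : A → ℤ) :
    IsCompact (flows tail head b l u) := by
  have : flows tail head b l u = Set.Icc (fun a => (l a : ℝ)) (fun a => (u a : ℝ)) ∩
      ⋂ n, {f | excess tail head n f = b n} := by
    ext f
    simp only [flows, Set.mem_ofPred_eq, Set.mem_inter_iff, Set.mem_Icc, Set.mem_iInter, Pi.le_def,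
      forall_and]
  rw [this]
  exact isCompact_Icc.inter_right (isClosed_iInter fun n =>
    isClosed_eq (LinearMap.continuous_of_finiteDimensional _) continuous_const)

/-- If some arc were fractional, the flow would be the midpoint of two feasible flows `f ± (r / 2) •
d`, with `d` a nonzero perturbation supported on the fractional arcs. -/
theorem extremePoint_integral [Fintype N] {tail head : A → N} {b : N → ℤ} {l u : A → ℤ}
    {f : A → ℝ} (hf : f ∈ (flows tail head b l u).extremePoints ℝ) (a : A) :
    f a ∈ integers := by
  by_contra ha
  obtain ⟨⟨hbd, hex⟩, hext⟩ := mem_extremePoints_iff_left.1 hf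
  obtain ⟨d, hd0, hdF, hdex⟩ := exists_perturbation tail head f
    (fun n => by rw [hex]; exact ⟨b n, rfl⟩) ⟨a, ha⟩
  -- The bounds are integers, so they are strict on fractional arcs and survive small changes; on
  -- the other arcs `d` vanishes.
  have hev : ∀ᶠ ε : ℝ in nhds 0, ∀ a, (l a : ℝ) ≤ f a + ε * d a ∧ f a + ε * d a ≤ u a := by
    refine Filter.eventually_all.2 fun a => ?_
    by_cases hfa : f a ∈ integers
    · rw [hdF a hfa]
      simpa using hbd a
    · have hl : (l a : ℝ) < f a := lt_of_le_of_ne (hbd a).1 fun h => hfa ⟨l a, h⟩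
      have hu : f a < (u a : ℝ) := lt_of_le_of_ne (hbd a).2 fun h => hfa ⟨u a, h.symm⟩
      have hc : Filter.Tendsto (fun ε : ℝ => f a + ε * d a) (nhds 0) (nhds (f a)) := by
        have : Continuous fun ε : ℝ => f a + ε * d a := by fun_prop
        simpa using this.tendsto 0
      filter_upwards [hc.eventually (lt_mem_nhds hl), hc.eventually (gt_mem_nhds hu)] with ε h1 h2
      exact ⟨h1.le, h2.le⟩
  obtain ⟨r, hr, hball⟩ := Metric.eventually_nhds_iff.1 hev
  have hmem : ∀ ε : ℝ, |ε| < r → f + ε • d ∈ flows tail head b l u := fun ε hε =>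
    ⟨fun a => hball (by simpa using hε) a, fun n => by
      rw [map_add, map_smul, hdex, smul_zero, add_zero, hex]⟩
  have habs : |r / 2| < r := by rw [abs_of_pos (by positivity)]; linarith
  have := hext _ (hmem (r / 2) habs) _ (hmem (-(r / 2)) (by rwa [abs_neg]))
    ⟨1 / 2, 1 / 2, by norm_num, by norm_num, by norm_num, by
      ext a; simp only [Pi.add_apply, Pi.smul_apply, smul_eq_mul]; ring⟩
  refine hd0 ?_
  have h0 : (r / 2) • d = 0 := by simpa using this
  exact (smul_eq_zero.1 h0).resolve_left (by positivity)

/-- Finiteness makes the hull of the integral flows closed, which absorbs the closure in the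
Krein–Milman theorem. -/
theorem finite_integral_flows (tail head : A → N) (b : N → ℤ) (l u : A → ℤ) :
    {f ∈ flows tail head b l u | ∀ a, f a ∈ integers}.Finite := by
  classical
  refine ((Set.finite_Icc l u).image fun k a => (k a : ℝ)).subset ?_
  rintro f ⟨⟨hbd, -⟩, hint⟩
  choose k hk using hint
  obtain rfl : (fun a => (k a : ℝ)) = f := funext hk
  exact ⟨k, ⟨fun a => Int.cast_le.1 (hbd a).1, fun a => Int.cast_le.1 (hbd a).2⟩, rfl⟩

/-- The polytope of flows with integral data is the convex hull of its integral points. -/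
theorem flows_subset_convexHull [Fintype N] (tail head : A → N) (b : N → ℤ) (l u : A → ℤ) :
    flows tail head b l u ⊆
      convexHull ℝ {f ∈ flows tail head b l u | ∀ a, f a ∈ integers} := by
  intro f hf
  rw [← closure_convexHull_extremePoints (isCompact_flows tail head b l u)
    (convex_flows tail head b l u)] at hf
  have hsub : (flows tail head b l u).extremePoints ℝ ⊆
      {f ∈ flows tail head b l u | ∀ a, f a ∈ integers} := fun g hg =>
    ⟨extremePoints_subset hg, extremePoint_integral hg⟩
  exact closure_minimal (convexHull_mono hsub)
    ((finite_integral_flows tail head b l u).isClosed_convexHull ℝ) hf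

end Excess

end IntegralFlow

/-! ### The hull of the link selections, and the network that describes it. -/

namespace PairSelection

open Finset IntegralFlow

variable {X Y E K L : Type*} [Fintype X] [Fintype Y] [Fintype E] [Fintype K] [Fintype L]
  [DecidableEq X] [DecidableEq Y] [DecidableEq K] [DecidableEq L]

/-- The binary points `(x, y, z)` that select one element from each fibre of `π` and `ρ`, and at
least one link `e`, where a selected link has both its ends `a e` and `b e` selected. -/
def binaryPoints (a : E → X) (b : E → Y) (π : X → K) (ρ : Y → L) :
    Set ((X → ℝ) × (Y → ℝ) × (E → ℝ)) :=
  {p | ((∀ i, p.1 i = 0 ∨ p.1 i = 1) ∧ (∀ j, p.2.1 j = 0 ∨ p.2.1 j = 1) ∧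
      ∀ e, p.2.2 e = 0 ∨ p.2.2 e = 1) ∧
    (∀ k, ∑ i with π i = k, p.1 i = 1) ∧ (∀ l, ∑ j with ρ j = l, p.2.1 j = 1) ∧
    (∀ e, p.2.2 e ≤ p.1 (a e)) ∧ (∀ e, p.2.2 e ≤ p.2.1 (b e)) ∧ 1 ≤ ∑ e, p.2.2 e}

/-- The linear description of the convex hull of `binaryPoints`. -/
def polytope (a : E → X) (b : E → Y) (π : X → K) (ρ : Y → L) :
    Set ((X → ℝ) × (Y → ℝ) × (E → ℝ)) :=
  {p | ((∀ i, p.1 i ∈ Set.Icc (0 : ℝ) 1) ∧ (∀ j, p.2.1 j ∈ Set.Icc (0 : ℝ) 1) ∧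
      ∀ e, p.2.2 e ∈ Set.Icc (0 : ℝ) 1) ∧
    (∀ k, ∑ i with π i = k, p.1 i = 1) ∧ (∀ l, ∑ j with ρ j = l, p.2.1 j = 1) ∧
    (∀ i, ∑ e with a e = i, p.2.2 e ≤ p.1 i) ∧ (∀ j, ∑ e with b e = j, p.2.2 e ≤ p.2.1 j) ∧
    1 ≤ ∑ e, p.2.2 e}

theorem convex_polytope (a : E → X) (b : E → Y) (π : X → K) (ρ : Y → L) :
    Convex ℝ (polytope a b π ρ) := by
  rintro p ⟨⟨hx, hy, hz⟩, hK, hL, ha, hb, hc⟩ q ⟨⟨hx', hy', hz'⟩, hK', hL', ha', hb', hc'⟩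
    s t hs ht hst
  refine ⟨⟨fun i => convex_Icc (0 : ℝ) 1 (hx i) (hx' i) hs ht hst,
    fun j => convex_Icc (0 : ℝ) 1 (hy j) (hy' j) hs ht hst,
    fun e => convex_Icc (0 : ℝ) 1 (hz e) (hz' e) hs ht hst⟩, fun k => ?_, fun l => ?_,
    fun i => ?_, fun j => ?_, ?_⟩ <;>
  simp only [Prod.fst_add, Prod.snd_add, Prod.smul_fst, Prod.smul_snd, Pi.add_apply, Pi.smul_apply,
    smul_eq_mul, sum_add_distrib, ← mul_sum]
  · rw [hK, hK', mul_one, mul_one, hst]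
  · rw [hL, hL', mul_one, mul_one, hst]
  · exact add_le_add (mul_le_mul_of_nonneg_left (ha i) hs) (mul_le_mul_of_nonneg_left (ha' i) ht)
  · exact add_le_add (mul_le_mul_of_nonneg_left (hb j) hs) (mul_le_mul_of_nonneg_left (hb' j) ht)
  · nlinarith

/-- The links at one node lead to distinct elements of one fibre, of which one is selected. -/
theorem sum_links_le {a : E → X} {b : E → Y} {ρ : Y → L} {x : X → ℝ} {y : Y → ℝ} {z : E → ℝ}
    (hinj : ∀ e e', a e = a e' → b e = b e' → e = e')
    (hfib : ∀ e e', a e = a e' → ρ (b e) = ρ (b e'))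
    (hx : ∀ i, x i = 0 ∨ x i = 1) (hy : ∀ j, y j = 0 ∨ y j = 1)
    (hL : ∀ l, ∑ j with ρ j = l, y j = 1)
    (ha : ∀ e, z e ≤ x (a e)) (hb : ∀ e, z e ≤ y (b e)) (i : X) :
    ∑ e with a e = i, z e ≤ x i := by
  classical
  rcases hx i with h | h
  · rw [h]
    refine sum_nonpos fun e he => ?_
    rw [← h, ← (mem_filter.1 he).2]
    exact ha e
  · rw [h]
    rcases ({e | a e = i} : Finset E).eq_empty_or_nonempty with h0 | ⟨e₀, he₀⟩
    · rw [h0, sum_empty]; exact zero_le_one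
    · have hae : ∀ e ∈ ({e | a e = i} : Finset E), a e = i := fun e he => (mem_filter.1 he).2
      calc ∑ e with a e = i, z e ≤ ∑ e with a e = i, y (b e) := sum_le_sum fun e _ => hb e
        -- Without parallel links, distinct links at `i` have distinct other ends.
        _ = ∑ j ∈ image b {e | a e = i}, y j :=
          (sum_image fun e he e' he' hbe =>
            hinj e e' ((hae e he).trans (hae e' he').symm) hbe).symm
        _ ≤ ∑ j with ρ j = ρ (b e₀), y j := by
          refine sum_le_sum_of_subset_of_nonneg (fun j hj => ?_) fun j _ _ => ?_
          · obtain ⟨e, he, rfl⟩ := mem_image.1 hj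
            exact mem_filter.2 ⟨mem_univ _, hfib e e₀ ((hae e he).trans (hae e₀ he₀).symm)⟩
          · rcases hy j with h | h <;> simp [h]
        _ = 1 := hL _

theorem binaryPoints_subset_polytope {a : E → X} {b : E → Y} {π : X → K} {ρ : Y → L}
    (hinj : ∀ e e', a e = a e' → b e = b e' → e = e')
    (hρ : ∀ e e', a e = a e' → ρ (b e) = ρ (b e'))
    (hπ : ∀ e e', b e = b e' → π (a e) = π (a e')) :
    binaryPoints a b π ρ ⊆ polytope a b π ρ := by
  rintro p ⟨⟨hx, hy, hz⟩, hK, hL, ha, hb, hc⟩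
  have hbox : ∀ r : ℝ, r = 0 ∨ r = 1 → r ∈ Set.Icc (0 : ℝ) 1 := by
    rintro r (rfl | rfl) <;> simp
  exact ⟨⟨fun i => hbox _ (hx i), fun j => hbox _ (hy j), fun e => hbox _ (hz e)⟩, hK, hL,
    sum_links_le hinj hρ hx hy hL ha hb,
    sum_links_le (fun e e' h h' => hinj e e' h' h) hπ hy hx hK hb ha, hc⟩

/-- The nodes of the network: the ends of the links, the classes of ends, and two nodes that
collect and supply the slack. -/
abbrev Node (X Y K L : Type*) := X ⊕ Y ⊕ K ⊕ L ⊕ Bool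

/-- The arcs of the network: one for each variable, one for each slack variable, and one from the
collector to the supplier of the slack. -/
abbrev Arc (X Y E : Type*) := X ⊕ Y ⊕ E ⊕ X ⊕ Y ⊕ Unit

def tail (a : E → X) (π : X → K) : Arc X Y E → Node X Y K L
  | .inl i => .inr (.inr (.inl (π i)))
  | .inr (.inl j) => .inr (.inl j)
  | .inr (.inr (.inl e)) => .inl (a e)
  | .inr (.inr (.inr (.inl i))) => .inl i
  | .inr (.inr (.inr (.inr (.inl _)))) => .inr (.inr (.inr (.inr false)))
  | .inr (.inr (.inr (.inr (.inr _)))) => .inr (.inr (.inr (.inr true)))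

def head (b : E → Y) (ρ : Y → L) : Arc X Y E → Node X Y K L
  | .inl i => .inl i
  | .inr (.inl j) => .inr (.inr (.inr (.inl (ρ j))))
  | .inr (.inr (.inl e)) => .inr (.inl (b e))
  | .inr (.inr (.inr (.inl _))) => .inr (.inr (.inr (.inr true)))
  | .inr (.inr (.inr (.inr (.inl j)))) => .inr (.inl j)
  | .inr (.inr (.inr (.inr (.inr _)))) => .inr (.inr (.inr (.inr false)))

/-- The value at the supplier `false` makes all supplies add up to zero. -/
def supply : Node X Y K L → ℤ
  | .inl _ => 0
  | .inr (.inl _) => 0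
  | .inr (.inr (.inl _)) => 1
  | .inr (.inr (.inr (.inl _))) => -1
  | .inr (.inr (.inr (.inr true))) => 0
  | .inr (.inr (.inr (.inr false))) => Fintype.card L - Fintype.card K

/-- The last value bounds the total slack on the `X` side and encodes `z(E) ≥ 1`. The unit
capacities of the slack arcs exclude nothing, since a slack is at most its variable `x i` or `y j`.
-/
def capacity (K : Type*) [Fintype K] : Arc X Y E → ℤ
  | .inl _ => 1
  | .inr (.inl _) => 1
  | .inr (.inr (.inl _)) => 1
  | .inr (.inr (.inr (.inl _))) => 1
  | .inr (.inr (.inr (.inr (.inl _)))) => 1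
  | .inr (.inr (.inr (.inr (.inr _)))) => Fintype.card K - 1

/-- The arc that carries the variable `x i`, `y j`, or `z e`. -/
def project : (Arc X Y E → ℝ) →ₗ[ℝ] (X → ℝ) × (Y → ℝ) × (E → ℝ) where
  toFun f := (fun i => f (.inl i), fun j => f (.inr (.inl j)), fun e => f (.inr (.inr (.inl e))))
  map_add' _ _ := rfl
  map_smul' _ _ := rfl

theorem mem_flows_iff (a : E → X) (b : E → Y) (π : X → K) (ρ : Y → L) (f : Arc X Y E → ℝ) :
    f ∈ flows (tail a π) (head b ρ) (supply (X := X) (Y := Y) (K := K) (L := L)) 0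
      (capacity K) ↔
    (((∀ i, f (.inl i) ∈ Set.Icc (0 : ℝ) 1) ∧ (∀ j, f (.inr (.inl j)) ∈ Set.Icc (0 : ℝ) 1) ∧
      (∀ e, f (.inr (.inr (.inl e))) ∈ Set.Icc (0 : ℝ) 1) ∧
      (∀ i, f (.inr (.inr (.inr (.inl i)))) ∈ Set.Icc (0 : ℝ) 1) ∧
      (∀ j, f (.inr (.inr (.inr (.inr (.inl j))))) ∈ Set.Icc (0 : ℝ) 1) ∧
      f (.inr (.inr (.inr (.inr (.inr ()))))) ∈ Set.Icc (0 : ℝ) (Fintype.card K - 1)) ∧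
    (∀ i, ∑ e with a e = i, f (.inr (.inr (.inl e))) + f (.inr (.inr (.inr (.inl i)))) =
      f (.inl i)) ∧
    (∀ j, ∑ e with b e = j, f (.inr (.inr (.inl e))) + f (.inr (.inr (.inr (.inr (.inl j))))) =
      f (.inr (.inl j))) ∧
    (∀ k, ∑ i with π i = k, f (.inl i) = 1) ∧
    (∀ l, ∑ j with ρ j = l, f (.inr (.inl j)) = 1) ∧
    ∑ i, f (.inr (.inr (.inr (.inl i)))) = f (.inr (.inr (.inr (.inr (.inr ()))))) ∧
    ∑ j, f (.inr (.inr (.inr (.inr (.inl j))))) - f (.inr (.inr (.inr (.inr (.inr ()))))) =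
      Fintype.card L - Fintype.card K) := by
  simp only [flows, Set.mem_ofPred_eq, Sum.forall, excess_apply, Fintype.sum_sum_type, tail, head,
    supply, capacity, Bool.forall_bool, reduceCtorEq, if_false, Sum.inl.injEq, Sum.inr.injEq,
    sum_const_zero, sum_ite_eq', mem_univ, if_true, Set.mem_Icc, univ_unique, sum_singleton,
    add_zero, zero_add, Pi.zero_apply, Int.cast_zero, Int.cast_one, sub_zero, zero_sub,
    sum_filter]
  refine and_congr ?_ ⟨?_, ?_⟩
  · push_cast
    simp only [Unique.forall_iff]
  · rintro ⟨h1, h2, h3, h4, h5, h6⟩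
    refine ⟨fun i => ?_, fun j => ?_, fun k => ?_, fun l => ?_, ?_, ?_⟩
    · linarith [h1 i]
    · linarith [h2 j]
    · linarith [h3 k]
    · have := h4 l; push_cast at this; linarith
    · linarith
    · push_cast at h5; linarith
  · rintro ⟨h1, h2, h3, h4, h5, h6⟩
    refine ⟨fun i => ?_, fun j => ?_, fun k => ?_, fun l => ?_, ?_, ?_⟩
    · linarith [h1 i]
    · linarith [h2 j]
    · linarith [h3 k]
    · have := h4 l; push_cast; linarith
    · push_cast; linarith
    · linarith

theorem sum_fibres (π : X → K) (x : X → ℝ) (h : ∀ k, ∑ i with π i = k, x i = 1) :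
    ∑ i, x i = Fintype.card K := by
  rw [← sum_fiberwise univ π x, sum_congr rfl fun k _ => h k]
  simp

/-- The aggregated inequalities are precisely the nonnegativity of the slacks `sx` and `sy`, so a
point of the polytope extends to a flow. -/
theorem polytope_subset_image (a : E → X) (b : E → Y) (π : X → K) (ρ : Y → L) :
    polytope a b π ρ ⊆ project ''
      flows (tail a π) (head b ρ) (supply (X := X) (Y := Y) (K := K) (L := L)) 0
        (capacity K) := by
  rintro ⟨x, y, z⟩ ⟨⟨hx, hy, hz⟩, hK, hL, ha, hb, hc⟩
  dsimp only at hx hy hz hK hL ha hb hc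
  let sx : X → ℝ := fun i => x i - ∑ e with a e = i, z e
  let sy : Y → ℝ := fun j => y j - ∑ e with b e = j, z e
  have hsx : ∑ i, sx i = Fintype.card K - ∑ e, z e := by
    simp only [sx, sum_sub_distrib, sum_fibres π x hK, sum_fiberwise]
  have hsy : ∑ j, sy j = Fintype.card L - ∑ e, z e := by
    simp only [sy, sum_sub_distrib, sum_fibres ρ y hL, sum_fiberwise]
  have hx0 : ∀ i, 0 ≤ ∑ e with a e = i, z e := fun i => sum_nonneg fun e _ => (hz e).1
  have hy0 : ∀ j, 0 ≤ ∑ e with b e = j, z e := fun j => sum_nonneg fun e _ => (hz e).1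
  refine ⟨Sum.elim x (Sum.elim y (Sum.elim z (Sum.elim sx (Sum.elim sy fun _ => ∑ i, sx i)))),
    (mem_flows_iff a b π ρ _).2 ⟨⟨hx, hy, hz, fun i => ?_, fun j => ?_, ?_⟩,
      fun i => ?_, fun j => ?_, hK, hL, rfl, ?_⟩, rfl⟩ <;>
  simp only [Sum.elim_inl, Sum.elim_inr]
  · exact ⟨sub_nonneg.2 (ha i), by have := (hx i).2; have := hx0 i; simp only [sx]; linarith⟩
  · exact ⟨sub_nonneg.2 (hb j), by have := (hy j).2; have := hy0 j; simp only [sy]; linarith⟩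
  -- The upper bound is `∑ sx = |K| - z(E) ≤ |K| - 1`.
  · exact ⟨sum_nonneg fun i _ => sub_nonneg.2 (ha i), by linarith⟩
  · simp only [sx]; ring
  · simp only [sy]; ring
  · linarith

theorem eq_zero_or_one_of_mem_integers {r : ℝ} (h : r ∈ integers) (hr : r ∈ Set.Icc (0 : ℝ) 1) :
    r = 0 ∨ r = 1 := by
  obtain ⟨k, rfl⟩ := h
  simp only [Int.coe_castAddHom, Set.mem_Icc] at hr ⊢
  have h0 : 0 ≤ k := by exact_mod_cast hr.1
  have h1 : k ≤ 1 := by exact_mod_cast hr.2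
  norm_cast
  omega

theorem project_mem_binaryPoints {a : E → X} {b : E → Y} {π : X → K} {ρ : Y → L}
    {f : Arc X Y E → ℝ}
    (hf : f ∈ flows (tail a π) (head b ρ) (supply (X := X) (Y := Y) (K := K) (L := L)) 0
        (capacity K)) (hint : ∀ c, f c ∈ integers) :
    project f ∈ binaryPoints a b π ρ := by
  obtain ⟨⟨hx, hy, hz, hsx, hsy, hg⟩, ha, hb, hK, hL, hS, -⟩ := (mem_flows_iff a b π ρ f).1 hf
  have hle : ∀ (S : Finset E) (e), e ∈ S →
      f (.inr (.inr (.inl e))) ≤ ∑ e ∈ S, f (.inr (.inr (.inl e))) := fun S e he =>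
    single_le_sum (f := fun e => f (.inr (.inr (.inl e)))) (fun e _ => (hz e).1) he
  refine ⟨⟨fun i => eq_zero_or_one_of_mem_integers (hint _) (hx i),
    fun j => eq_zero_or_one_of_mem_integers (hint _) (hy j),
    fun e => eq_zero_or_one_of_mem_integers (hint _) (hz e)⟩, hK, hL, fun e => ?_, fun e => ?_, ?_⟩
  · have h1 := hle {e' | a e' = a e} e (by simp)
    have h2 := ha (a e)
    have h3 := (hsx (a e)).1
    simp only [project, LinearMap.coe_mk, AddHom.coe_mk]
    linarith
  · have h1 := hle {e' | b e' = b e} e (by simp)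
    have h2 := hb (b e)
    have h3 := (hsy (b e)).1
    simp only [project, LinearMap.coe_mk, AddHom.coe_mk]
    linarith
  -- Summing conservation over all of `X` gives `z(E)` plus the bottleneck flow equal to `|K|`; the
  -- bottleneck carries at most `|K| - 1`.
  · have h1 := sum_congr (rfl : (univ : Finset X) = univ) fun i _ => ha i
    rw [sum_add_distrib, sum_fiberwise, sum_fibres π _ hK, hS] at h1
    have h2 := hg.2
    simp only [project, LinearMap.coe_mk, AddHom.coe_mk]
    linarith

theorem convexHull_binaryPoints {a : E → X} {b : E → Y} {π : X → K} {ρ : Y → L}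
    (hinj : ∀ e e', a e = a e' → b e = b e' → e = e')
    (hρ : ∀ e e', a e = a e' → ρ (b e) = ρ (b e'))
    (hπ : ∀ e e', b e = b e' → π (a e) = π (a e')) :
    convexHull ℝ (binaryPoints a b π ρ) = polytope a b π ρ := by
  refine (convexHull_min (binaryPoints_subset_polytope hinj hρ hπ)
    (convex_polytope a b π ρ)).antisymm fun p hp => ?_
  obtain ⟨f, hf, rfl⟩ := polytope_subset_image a b π ρ hp
  have h := Set.mem_image_of_mem (project (X := X) (Y := Y) (E := E))
    (flows_subset_convexHull _ _ _ _ _ hf)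
  rw [LinearMap.image_convexHull] at h
  refine convexHull_mono ?_ h
  rintro _ ⟨g, ⟨hg, hint⟩, rfl⟩
  exact project_mem_binaryPoints hg hint

end PairSelection

namespace PartitionPolytope

open Finset PairSelection

/-! ### Transfer to bipartite graphs with partitioned sides. -/

section Bipartite

variable {V : Type u} [Fintype V] [DecidableEq V] {G : SimpleGraph V} [DecidableRel G.Adj]
  {X Y : Finset V}

/-- The restriction of a point to the coordinates in `X`, in `Y`, and in the edge set. -/
def split (X Y : Finset V) : Point G →ₗ[ℝ] (X → ℝ) × (Y → ℝ) × (G.edgeSet → ℝ) where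
  toFun p := (fun i => p.1 i, fun j => p.1 j, p.2)
  map_add' _ _ := rfl
  map_smul' _ _ := rfl

theorem split_bijective (hd : Disjoint X Y) (hc : X ∪ Y = univ) :
    Function.Bijective (split (G := G) X Y) := by
  refine ⟨fun p q h => ?_, fun ⟨x, y, z⟩ => ?_⟩
  · obtain ⟨hx, h⟩ := Prod.ext_iff.1 h
    obtain ⟨hy, hz⟩ := Prod.ext_iff.1 h
    refine Prod.ext (funext fun v => ?_) hz
    rcases mem_union.1 (hc ▸ mem_univ v : v ∈ X ∪ Y) with hv | hv
    · exact congrFun hx ⟨v, hv⟩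
    · exact congrFun hy ⟨v, hv⟩
  · refine ⟨(fun v => if h : v ∈ X then x ⟨v, h⟩ else if h : v ∈ Y then y ⟨v, h⟩ else 0, z),
      Prod.ext (funext fun i => ?_) (Prod.ext (funext fun j => ?_) rfl)⟩
    · exact dif_pos i.2
    · exact (dif_neg fun h => disjoint_left.1 hd h j.2).trans (dif_pos j.2)

/-- This carries the hull identity back along the linear changes of coordinates `split` and
`uncurry`. -/
theorem convexHull_preimage {E F : Type*} [AddCommGroup E] [Module ℝ E] [AddCommGroup F]
    [Module ℝ F] (f : E →ₗ[ℝ] F) (hf : Function.Bijective f) (s : Set F) :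
    convexHull ℝ (f ⁻¹' s) = f ⁻¹' convexHull ℝ s := by
  rw [← Set.image_preimage_eq s hf.2, ← LinearMap.image_convexHull,
    Set.preimage_image_eq _ hf.1, Set.preimage_image_eq _ hf.1]

/-- The part of `P` that contains a given element. -/
def partMap {S : Finset V} (P : Finpartition S) (i : S) : {I // I ∈ P.parts} :=
  ⟨P.part i, P.part_mem.2 i.2⟩

theorem sum_partMap {S : Finset V} (P : Finpartition S) (w : V → ℝ) (I : {I // I ∈ P.parts}) :
    ∑ i : S with partMap P i = I, w i = ∑ i ∈ I.1, w i := by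
  refine sum_bij (fun i _ => i.1) (fun i hi => ?_) (fun i _ j _ h => Subtype.ext h)
    (fun v hv => ?_) fun _ _ => rfl
  · rw [← congrArg Subtype.val (mem_filter.1 hi).2]
    exact P.mem_part_self.2 i.2
  · exact ⟨⟨v, P.le I.2 hv⟩,
      mem_filter.2 ⟨mem_univ _, Subtype.ext (P.part_eq_of_mem I.2 hv)⟩, rfl⟩

theorem forall_sum_partMap {S : Finset V} (P : Finpartition S) (p : Point G) :
    (∀ I, ∑ i : S with partMap P i = I, p.1 i = 1) ↔ p.SumsToOne P := by
  simp only [sum_partMap, Point.SumsToOne, Subtype.forall]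

theorem forall_mem_iff {X Y : Finset V} (hc : X ∪ Y = univ) (q : V → Prop) :
    (∀ v, q v) ↔ (∀ i : X, q i) ∧ ∀ j : Y, q j := by
  refine ⟨fun h => ⟨fun i => h i, fun j => h j⟩, fun ⟨hx, hy⟩ v => ?_⟩
  rcases mem_union.1 (hc ▸ mem_univ v : v ∈ X ∪ Y) with hv | hv
  · exact hx ⟨v, hv⟩
  · exact hy ⟨v, hv⟩

theorem exists_ends (hG : G.IsBipartiteWith (X : Set V) (Y : Set V)) (e : G.edgeSet) :
    ∃ i : X, ∃ j : Y, e.1 = s(i.1, j.1) := by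
  obtain ⟨e, he⟩ := e
  induction e using Sym2.ind with
  | _ v w =>
    rcases hG.mem_of_adj he with ⟨hv, hw⟩ | ⟨hv, hw⟩
    · exact ⟨⟨v, hv⟩, ⟨w, hw⟩, rfl⟩
    · exact ⟨⟨w, hw⟩, ⟨v, hv⟩, Sym2.eq_swap⟩

theorem ends_eq (hd : Disjoint X Y) {i i' : X} {j j' : Y} (h : s(i.1, j.1) = s(i'.1, j'.1)) :
    i = i' ∧ j = j' := by
  rcases Sym2.eq_iff.1 h with ⟨h1, h2⟩ | ⟨h1, -⟩
  · exact ⟨Subtype.ext h1, Subtype.ext h2⟩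
  · exact absurd j'.2 (disjoint_left.1 hd (h1 ▸ i.2))

/-- The edges whose end in `S` is `i` correspond to the neighbours of `i`. -/
theorem sum_edges_eq_sum_neighborSet {S R : Finset V} (hd : Disjoint S R) {a : G.edgeSet → S}
    {b : G.edgeSet → R} (hab : ∀ e, e.1 = s((a e).1, (b e).1)) (z : G.edgeSet → ℝ) (i : S) :
    ∑ e with a e = i, z e = ∑ j : G.neighborSet i.1, z ⟨s(i.1, j.1), j.2⟩ := by
  symm
  refine sum_bij (fun j _ => ⟨s(i.1, j.1), j.2⟩) (fun j _ => ?_) (fun j _ j' _ h => ?_)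
    (fun e he => ?_) fun _ _ => rfl
  · refine mem_filter.2 ⟨mem_univ _, ?_⟩
    rcases Sym2.eq_iff.1 (hab ⟨s(i.1, j.1), j.2⟩) with ⟨h, -⟩ | ⟨h, -⟩
    · exact (Subtype.ext h).symm
    · exact absurd (b _).2 (disjoint_left.1 hd (h ▸ i.2))
  · exact Subtype.ext (Sym2.congr_right.1 (Subtype.ext_iff.1 h))
  · obtain rfl := (mem_filter.1 he).2
    have hadj : G.Adj (a e).1 (b e).1 := by
      have := e.2
      rwa [hab e] at this
    exact ⟨⟨(b e).1, hadj⟩, mem_univ _, Subtype.ext (hab e).symm⟩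

theorem hullQ_eq_polyP (hG : G.IsBipartiteWith (X : Set V) (Y : Set V)) (hc : X ∪ Y = univ)
    (PX : Finpartition X) (PY : Finpartition Y)
    (hX : ∀ i ∈ X, ∃ J ∈ PY.parts, G.neighborSet i ⊆ (J : Set V))
    (hY : ∀ j ∈ Y, ∃ I ∈ PX.parts, G.neighborSet j ⊆ (I : Set V)) :
    hullQ G PX PY = polyP G PX PY := by
  have hd : Disjoint X Y := disjoint_coe.1 hG.disjoint
  choose a b hab using exists_ends hG
  have hadj : ∀ e, G.Adj (a e).1 (b e).1 := fun e => by
    have := e.2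
    rwa [hab e] at this
  have hends : ∀ i : X, ∀ j : Y, ∀ h : G.Adj i.1 j.1,
      a ⟨s(i.1, j.1), h⟩ = i ∧ b ⟨s(i.1, j.1), h⟩ = j := fun i j h =>
    ends_eq hd (hab ⟨s(i.1, j.1), h⟩).symm
  have hz : ∀ (p : Point G) e, p.z (hadj e) = p.2 e := fun p e =>
    congrArg p.2 (Subtype.ext (hab e).symm)
  have hbin : {p : Point G | p.IsBinary ∧ p.SumsToOne PX ∧ p.SumsToOne PY ∧
      (∀ i ∈ X, ∀ j ∈ Y, ∀ h : G.Adj i j, p.z h ≤ p.1 i) ∧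
      (∀ i ∈ X, ∀ j ∈ Y, ∀ h : G.Adj i j, p.z h ≤ p.1 j) ∧ p.CoversOne} =
      split X Y ⁻¹' binaryPoints a b (partMap PX) (partMap PY) := by
    ext p
    have h1 : (∀ i ∈ X, ∀ j ∈ Y, ∀ h : G.Adj i j, p.z h ≤ p.1 i) ↔ ∀ e, p.2 e ≤ p.1 (a e) := by
      refine ⟨fun h e => hz p e ▸ h _ (a e).2 _ (b e).2 (hadj e), fun h i hi j hj hij => ?_⟩
      have := h ⟨s(i, j), hij⟩
      rwa [(hends ⟨i, hi⟩ ⟨j, hj⟩ hij).1] at this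
    have h2 : (∀ i ∈ X, ∀ j ∈ Y, ∀ h : G.Adj i j, p.z h ≤ p.1 j) ↔ ∀ e, p.2 e ≤ p.1 (b e) := by
      refine ⟨fun h e => hz p e ▸ h _ (a e).2 _ (b e).2 (hadj e), fun h i hi j hj hij => ?_⟩
      have := h ⟨s(i, j), hij⟩
      rwa [(hends ⟨i, hi⟩ ⟨j, hj⟩ hij).2] at this
    simp only [Set.mem_ofPred_eq, Set.mem_preimage, binaryPoints, split, LinearMap.coe_mk,
      AddHom.coe_mk, forall_sum_partMap, h1, h2, Point.IsBinary, Point.CoversOne,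
      forall_mem_iff hc fun v => p.1 v = 0 ∨ p.1 v = 1, and_assoc]
  have hpoly : polyP G PX PY = split X Y ⁻¹' polytope a b (partMap PX) (partMap PY) := by
    ext p
    have h1 : (∀ i ∈ X, ∑ j : G.neighborSet i, p.z j.2 ≤ p.1 i) ↔
        ∀ i, ∑ e with a e = i, p.2 e ≤ p.1 i := by
      simp only [sum_edges_eq_sum_neighborSet hd hab, Subtype.forall]
      rfl
    have h2 : (∀ j ∈ Y, ∑ i : G.neighborSet j, p.z (G.adj_symm i.2) ≤ p.1 j) ↔
        ∀ j, ∑ e with b e = j, p.2 e ≤ p.1 j := by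
      simp only [sum_edges_eq_sum_neighborSet hd.symm fun e => (hab e).trans Sym2.eq_swap,
        Subtype.forall]
      refine forall₂_congr fun j _ => ?_
      simp only [Point.z, Sym2.eq_swap]
    simp only [polyP, Set.mem_ofPred_eq, Set.mem_preimage, polytope, split, LinearMap.coe_mk,
      AddHom.coe_mk, forall_sum_partMap, h1, h2, Point.InUnitBox, Point.CoversOne,
      forall_mem_iff hc fun v => p.1 v ∈ Set.Icc (0 : ℝ) 1, and_assoc]
    exact ⟨fun ⟨hx, hy, hz, hX, hY, hE, ha, hb⟩ => ⟨hx, hy, hz, hX, hY, ha, hb, hE⟩,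
      fun ⟨hx, hy, hz, hX, hY, ha, hb, hE⟩ => ⟨hx, hy, hz, hX, hY, hE, ha, hb⟩⟩
  rw [hullQ, hbin, hpoly, convexHull_preimage _ (split_bijective hd hc), convexHull_binaryPoints]
  · exact fun e e' h h' => Subtype.ext (by rw [hab e, hab e', h, h'])
  -- Both links join the same node to neighbours of it, and these all lie in one part `J`.
  · intro e e' h
    obtain ⟨J, hJ, hN⟩ := hX _ (a e).2
    refine Subtype.ext ((PY.part_eq_of_mem hJ (hN (hadj e))).trans
      (PY.part_eq_of_mem hJ (hN ?_)).symm)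
    rw [h]; exact hadj e'
  · intro e e' h
    obtain ⟨I, hI, hN⟩ := hY _ (b e).2
    refine Subtype.ext ((PX.part_eq_of_mem hI (hN (hadj e).symm)).trans
      (PX.part_eq_of_mem hI (hN ?_)).symm)
    rw [h]; exact (hadj e').symm

end Bipartite

/-! ### Transfer to the connection polytope. -/

section Connection

variable {V : Type v} [Fintype V] [DecidableEq V] {H : SimpleGraph V} [DecidableRel H.Adj] {T : ℕ}

/-- The uncurried coordinates of a point. -/
def uncurry : ConnPoint H T →ₗ[ℝ] (Fin T × V → ℝ) × (Fin T × V → ℝ) × (Fin T × H.Dart → ℝ) where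
  toFun c := (fun i => c.wp i.1 i.2, fun j => c.wq j.1 j.2, fun e => c.y e.1 e.2)
  map_add' _ _ := rfl
  map_smul' _ _ := rfl

theorem uncurry_bijective : Function.Bijective (uncurry (H := H) (T := T)) := by
  refine ⟨fun c d h => ?_, fun ⟨x, y, z⟩ =>
    ⟨(fun t i => x (t, i), fun t i => y (t, i), fun t e => z (t, e)), rfl⟩⟩
  obtain ⟨hx, h⟩ := Prod.ext_iff.1 h
  obtain ⟨hy, hz⟩ := Prod.ext_iff.1 h
  exact Prod.ext (funext₂ fun t i => congrFun hx (t, i))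
    (Prod.ext (funext₂ fun t i => congrFun hy (t, i)) (funext₂ fun t e => congrFun hz (t, e)))

theorem sum_fst_eq {B : Type*} [Fintype B] (w : Fin T × B → ℝ) (t : Fin T) :
    ∑ i with i.1 = t, w i = ∑ i, w (t, i) := by
  rw [sum_filter, Fintype.sum_prod_type_right]
  simp

theorem sum_darts_fst (z : Fin T × H.Dart → ℝ) (t : Fin T) (i : V) :
    ∑ e with (e.1, e.2.fst) = (t, i), z e =
      ∑ j : H.neighborSet i, z (t, ⟨(i, j), j.2⟩) := by
  symm
  refine sum_bij (fun j _ => (t, ⟨(i, j), j.2⟩)) (fun j _ => by simp)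
    (fun j _ j' _ h => ?_) (fun e he => ?_) fun _ _ => rfl
  · exact Subtype.ext (congrArg (fun e : Fin T × H.Dart => e.2.snd) h)
  · obtain ⟨s, ⟨⟨v, w⟩, hvw⟩⟩ := e
    obtain ⟨rfl, rfl⟩ : s = t ∧ v = i := by simpa using he
    exact ⟨⟨w, hvw⟩, mem_univ _, rfl⟩

theorem sum_darts_snd (z : Fin T × H.Dart → ℝ) (t : Fin T) (i : V) :
    ∑ e with (e.1, e.2.snd) = (t, i), z e =
      ∑ j : H.neighborSet i, z (t, ⟨(j, i), H.adj_symm j.2⟩) := by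
  symm
  refine sum_bij (fun j _ => (t, ⟨(j, i), H.adj_symm j.2⟩)) (fun j _ => by simp)
    (fun j _ j' _ h => ?_) (fun e he => ?_) fun _ _ => rfl
  · exact Subtype.ext (congrArg (fun e : Fin T × H.Dart => e.2.fst) h)
  · obtain ⟨s, ⟨⟨v, w⟩, hvw⟩⟩ := e
    obtain ⟨rfl, rfl⟩ : s = t ∧ w = i := by simpa using he
    exact ⟨⟨v, H.adj_symm hvw⟩, mem_univ _, rfl⟩

/-- Both sides are copies of `Fin T × V`, partitioned into the time layers by `Prod.fst`, and the
links are the darts repeated at each step. A link stays in its layer, so the links at a node lead to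
a single class. -/
theorem connHull_eq_connPoly : connHull H T = connPoly H T := by
  let a : Fin T × H.Dart → Fin T × V := fun e => (e.1, e.2.fst)
  let b : Fin T × H.Dart → Fin T × V := fun e => (e.1, e.2.snd)
  have hbin : {c : ConnPoint H T | c.IsBinary ∧ c.Assigned ∧ c.Meets ∧
      (∀ t a, c.y t a ≤ c.wp t a.fst) ∧ (∀ t a, c.y t a ≤ c.wq t a.snd)} =
      uncurry ⁻¹' binaryPoints a b Prod.fst Prod.fst := by
    ext c
    simp only [Set.mem_ofPred_eq, Set.mem_preimage, binaryPoints, uncurry, LinearMap.coe_mk,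
      AddHom.coe_mk, sum_fst_eq, ConnPoint.IsBinary, ConnPoint.Assigned, ConnPoint.Meets,
      Fintype.sum_prod_type, Prod.forall, a, b]
    tauto
  have hpoly : connPoly H T = uncurry ⁻¹' polytope a b Prod.fst Prod.fst := by
    ext c
    simp only [connPoly, Set.mem_ofPred_eq, Set.mem_preimage, polytope, uncurry, LinearMap.coe_mk,
      AddHom.coe_mk, sum_fst_eq, ConnPoint.InUnitBox, ConnPoint.Assigned, ConnPoint.Meets,
      Fintype.sum_prod_type, Prod.forall, a, b, sum_darts_fst, sum_darts_snd]
    tauto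
  rw [connHull, hbin, hpoly, convexHull_preimage _ uncurry_bijective, convexHull_binaryPoints]
  · rintro ⟨s, d⟩ ⟨t, d'⟩ h h'
    obtain ⟨rfl, h1⟩ := Prod.ext_iff.1 h
    exact Prod.ext rfl (SimpleGraph.Dart.ext _ _ (Prod.ext h1 (Prod.ext_iff.1 h').2))
  · exact fun e e' h => (Prod.ext_iff.1 h).1
  · exact fun e e' h => (Prod.ext_iff.1 h).1

end Connection

end PartitionPolytope

theorem mainTheorem7 :
    (∀ (V : Type u) [Fintype V] [DecidableEq V] (G : SimpleGraph V) [DecidableRel G.Adj]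
      (X Y : Finset V) (PX : Finpartition X) (PY : Finpartition Y),
      G.IsBipartiteWith (X : Set V) (Y : Set V) →
      X ∪ Y = Finset.univ →
      (∀ i ∈ X, ∃ J ∈ PY.parts, G.neighborSet i ⊆ (J : Set V)) →
      (∀ j ∈ Y, ∃ I ∈ PX.parts, G.neighborSet j ⊆ (I : Set V)) →
      PartitionPolytope.hullQ G PX PY = PartitionPolytope.polyP G PX PY) ∧
    (∀ (V : Type v) [Fintype V] [DecidableEq V] (H : SimpleGraph V) [DecidableRel H.Adj] (T : ℕ),
      PartitionPolytope.connHull H T = PartitionPolytope.connPoly H T) :=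
  ⟨fun _ _ _ _ _ _ _ PX PY hG hc hX hY =>
    PartitionPolytope.hullQ_eq_polyP hG hc PX PY hX hY,
    fun _ _ _ _ _ _ => PartitionPolytope.connHull_eq_connPoly⟩
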